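/- Let $k$ be an algebraically closed field. A variety over a field $F$ is a reduced, separated scheme of finite type over $F$ (not necessarily irreducible). For an irreducible variety $Z$ over an algebraically closed field $F$, let $\mathrm{Bir}_F(Z)$ be the group of birational transformations of $Z$ over $F$. An algebraic family of birational transformations of $Z$ parametrized by an $F$-variety $V$ is a $V$-birational map $\theta\colon V\times_F Z \dashrightarrow V\times_F Z$ that induces an isomorphism between open dense subsets of $V\times_F Z$ which both surject onto $V$; restricting $\theta$ to the fibres over the points of $V(F)$ gives a map $\rho_\theta\colon V(F)\to \mathrm{Bir}_F(Z)$. The Zariski topology on $\mathrm{Bir}_F(Z)$ is the finest topology for which all maps $\rho_\theta$ (for all $V$ and all $\theta$) are continuous, where $V(F)$ carries the Zariski topology. Let $\pi\colon X\to Y$ be a dominant morphism of irreducible varieties over $k$, let $\mathrm{Bir}(X/Y)=\{\varphi\in \mathrm{Bir}_k(X) : \pi\circ\varphi=\pi\}$, endowed with the subspace topology of the Zariski topology on $\mathrm{Bir}_k(X)$, let $K$ be an algebraic closure of the function field $k(Y)$, and let $X_K = X\times_Y \mathrm{Spec}(K)$ be the geometric generic fibre of $\pi$. Suppose that $X_K$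 is an irreducible $K$-variety. Then the natural group homomorphism $$\mathrm{Bir}(X/Y)\to \mathrm{Bir}_K(X_K),\qquad \varphi\mapsto\varphi_K,$$ which maps $\varphi$ to its base change along $\mathrm{Spec}(K)\to Y$, is injective, and it is continuous with respect to the Zariski topologies. -/

import Mathlib

open CategoryTheory CategoryTheory.Limits AlgebraicGeometry

universe u

noncomputable section

namespace BirationalFamilies

/-! ### The group of birational transformations -/

section Partial

variable {X Y Z S : Scheme.{u}}

instance isDominant_toPartialMap (e : X.PartialIso Y) : IsDominant e.toPartialMap.hom := by
  have := Opens.isDominant_ι e.dense_target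
  have : IsDominant (e.iso.hom ≫ e.target.ι) := inferInstance
  exact this

instance isOpenImmersion_toPartialMap (e : X.PartialIso Y) :
    IsOpenImmersion e.toPartialMap.hom := by
  have : IsOpenImmersion (e.iso.hom ≫ e.target.ι) := inferInstance
  exact this

/-- An open immersion with dense image, defined on a dense open subscheme,
is an isomorphism between dense open subschemes. -/
lemma exists_partialIso (f : X.PartialMap Y) [IsOpenImmersion f.hom] [IsDominant f.hom] :
    ∃ e : X.PartialIso Y, e.toPartialMap = f := by
  obtain ⟨U, hU, h⟩ := f
  change IsOpenImmersion h at *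
  change IsDominant h at *
  refine ⟨⟨U, hU, h.opensRange, h.denseRange, h.isoOpensRange⟩, ?_⟩
  have : h.isoOpensRange.hom ≫ h.opensRange.ι = h := by simp
  exact congrArg (Scheme.PartialMap.mk U hU) this

variable [IrreducibleSpace X] [IrreducibleSpace Y]

instance isOpenImmersion_comp (f : X.PartialMap Y) (g : Y.PartialMap Z) [IsDominant f.hom]
    [IsOpenImmersion f.hom] [IsOpenImmersion g.hom] : IsOpenImmersion (f.comp g).hom := by
  have : IsOpenImmersion ((f.domain.ι.isoImage _).inv ≫ f.hom ∣_ g.domain ≫ g.hom) :=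
    inferInstance
  exact this

lemma comp_hom_comp {sX : X ⟶ S} {sY : Y ⟶ S} {sZ : Z ⟶ S} (f : X.PartialMap Y)
    (g : Y.PartialMap Z) [IsDominant f.hom] (hf : f.hom ≫ sY = f.domain.ι ≫ sX)
    (hg : g.hom ≫ sZ = g.domain.ι ≫ sY) :
    (f.comp g).hom ≫ sZ = (f.comp g).domain.ι ≫ sX := by
  have : ((f.domain.ι.isoImage _).inv ≫ f.hom ∣_ g.domain ≫ g.hom) ≫ sZ =
      (f.domain.ι ''ᵁ f.hom ⁻¹ᵁ g.domain).ι ≫ sX := by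
    simp [hg, hf]
  exact this

lemma exists_partialIso_comp {sX : X ⟶ S} {sY : Y ⟶ S} {sZ : Z ⟶ S} (e : X.PartialIso Y)
    (f : Y.PartialIso Z) (he : e.IsOver sX sY) (hf : f.IsOver sY sZ) :
    ∃ h : X.PartialIso Z, h.IsOver sX sZ ∧
      h.toRationalMap = e.toRationalMap.comp f.toRationalMap := by
  obtain ⟨h, hh⟩ := exists_partialIso (e.toPartialMap.comp f.toPartialMap)
  refine ⟨h, ?_, ?_⟩
  · have h1 : e.toPartialMap.hom ≫ sY = e.toPartialMap.domain.ι ≫ sX :=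
      (Category.assoc _ _ _).trans he
    have h2 : f.toPartialMap.hom ≫ sZ = f.toPartialMap.domain.ι ≫ sY :=
      (Category.assoc _ _ _).trans hf
    have key := comp_hom_comp e.toPartialMap f.toPartialMap h1 h2
    rw [← hh] at key
    exact (Category.assoc _ _ _).symm.trans key
  · rw [Scheme.RationalMap.toRationalMap_comp]
    exact congrArg _ hh

lemma comp_symm (e : X.PartialIso Y) :
    e.toRationalMap.comp e.symm.toRationalMap = Scheme.RationalMap.id X := by
  rw [Scheme.RationalMap.toRationalMap_comp, Scheme.PartialMap.toRationalMap_eq_iff]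
  refine ⟨_, Scheme.PartialMap.dense_domain _, le_rfl, le_top, ?_⟩
  obtain ⟨U, hU, V, hV, i⟩ := e
  have h : ((i.hom ≫ V.ι) ∣_ V) = ((i.hom ≫ V.ι) ⁻¹ᵁ V).ι ≫ i.hom := by
    rw [← cancel_mono V.ι, morphismRestrict_ι, Category.assoc]
  have key : X.homOfLE le_rfl ≫ (U.ι.isoImage ((i.hom ≫ V.ι) ⁻¹ᵁ V)).inv ≫
      ((i.hom ≫ V.ι) ∣_ V) ≫ i.inv ≫ U.ι =
      X.homOfLE (le_top : U.ι ''ᵁ ((i.hom ≫ V.ι) ⁻¹ᵁ V) ≤ ⊤) ≫ X.topIso.hom ≫ 𝟙 X := by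
    rw [h, Category.comp_id, X.topIso_hom, X.homOfLE_ι]
    simp
  exact key

lemma comp_congr {f f' : X ⤏ Y} [f.IsDominant] [f'.IsDominant] (h : f = f') {g g' : Y ⤏ Z}
    (h' : g = g') : f.comp g = f'.comp g' := by
  subst h h'; rfl

end Partial

/-- The group `Bir_S(X)` of birational transformations of the irreducible `S`-scheme `X`:
the rational maps from `X` to itself which are represented by an `S`-isomorphism between
two dense open subschemes of `X`. -/
def Bir {X S : Scheme.{u}} (sX : X ⟶ S) : Type u :=
  {φ : X ⤏ X // ∃ e : X.PartialIso X, e.IsOver sX sX ∧ e.toRationalMap = φ}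

section Group

variable {X S : Scheme.{u}} {sX : X ⟶ S}

/-- The birational transformation represented by a partial isomorphism. -/
def Bir.mk (e : X.PartialIso X) (he : e.IsOver sX sX) : Bir sX := ⟨e.toRationalMap, e, he, rfl⟩

instance (φ : Bir sX) : φ.1.IsDominant := by
  obtain ⟨_, e, -, rfl⟩ := φ
  infer_instance

lemma Bir.ext {φ ψ : Bir sX} (h : φ.1 = ψ.1) : φ = ψ := Subtype.ext h

variable [IrreducibleSpace X]

/-- The product is the composition: `(φ * ψ)(x) = φ (ψ x)`. -/
instance : Mul (Bir sX) where
  mul φ ψ := ⟨ψ.1.comp φ.1, by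
    obtain ⟨e, he, he'⟩ := φ.2
    obtain ⟨f, hf, hf'⟩ := ψ.2
    obtain ⟨h, hh, hh'⟩ := exists_partialIso_comp f e hf he
    refine ⟨h, hh, hh'.trans ?_⟩
    simp only [he', hf']⟩

instance : One (Bir sX) where
  one := ⟨Scheme.RationalMap.id X, ⟨⊤, dense_univ, ⊤, dense_univ, Iso.refl _⟩,
    Category.id_comp _, by
    have : 𝟙 (⊤ : X.Opens).toScheme ≫ (⊤ : X.Opens).ι = X.topIso.hom ≫ 𝟙 X := by simp
    exact congrArg (fun h ↦ (Scheme.PartialMap.mk ⊤ dense_univ h).toRationalMap) this⟩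

instance : Inv (Bir sX) where
  inv φ := Bir.mk φ.2.choose.symm φ.2.choose_spec.1.symm

lemma Bir.mul_val (φ ψ : Bir sX) : (φ * ψ).1 = ψ.1.comp φ.1 := rfl

lemma Bir.one_val : (1 : Bir sX).1 = Scheme.RationalMap.id X := rfl

lemma Bir.inv_mul_val (φ : Bir sX) : φ.1.comp (φ⁻¹).1 = Scheme.RationalMap.id X := by
  have := comp_symm φ.2.choose
  simp only [φ.2.choose_spec.2] at this
  exact this

instance : Group (Bir sX) := Group.ofLeftAxioms
  (fun a b c ↦ Bir.ext (by simp only [Bir.mul_val, Scheme.RationalMap.comp_assoc]))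
  (fun a ↦ Bir.ext (by simp only [Bir.mul_val, Bir.one_val, Scheme.RationalMap.comp_id]))
  (fun a ↦ Bir.ext (a.inv_mul_val))

/-- The subgroup `Bir(X/Y) = {φ ∈ Bir(X) | π ∘ φ = π}` for a morphism `π : X ⟶ Y`. -/
def relBir (sX : X ⟶ S) {Y : Scheme.{u}} [IrreducibleSpace Y] (π : X ⟶ Y) :
    Subgroup (Bir sX) where
  carrier := {φ | φ.1.compHom π = π.toRationalMap}
  mul_mem' {φ ψ} hφ hψ := by
    simp only [Set.mem_ofPred_eq] at hφ hψ ⊢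
    rw [Bir.mul_val, ← Scheme.RationalMap.comp_toRationalMap, Scheme.RationalMap.comp_assoc,
      Scheme.RationalMap.comp_toRationalMap, hφ, Scheme.RationalMap.comp_toRationalMap, hψ]
  one_mem' := by simp [Bir.one_val]
  inv_mem' {φ} hφ := by
    have h : (φ⁻¹).1.comp φ.1 = Scheme.RationalMap.id X := congrArg Subtype.val (mul_inv_cancel φ)
    have h1 : (φ⁻¹).1.comp (φ.1.compHom π) = π.toRationalMap := by
      rw [← Scheme.RationalMap.comp_toRationalMap, ← Scheme.RationalMap.comp_assoc]
      exact (comp_congr h rfl).trans (Scheme.RationalMap.id_comp _)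
    exact (Scheme.RationalMap.comp_toRationalMap _ _).symm.trans
      ((comp_congr rfl hφ.symm).trans h1)

end Group

/-! ### Base change of partial isomorphisms -/

section BaseChange

variable {X S X' S' : Scheme.{u}} {g' : X' ⟶ X} {p' : X' ⟶ S'} {p : X ⟶ S} {g : S' ⟶ S}

/-- The base change `f ×_S S'` of an `S`-morphism `f` between open subschemes of `X`. -/
def baseChangeHom (sq : IsPullback g' p' p g) {U V : X.Opens} (f : U.toScheme ⟶ V.toScheme)
    (hf : f ≫ V.ι ≫ p = U.ι ≫ p) : (g' ⁻¹ᵁ U).toScheme ⟶ (g' ⁻¹ᵁ V).toScheme :=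
  (isPullback_morphismRestrict g' V).lift ((g' ∣_ U) ≫ f)
    (sq.lift ((g' ∣_ U) ≫ f ≫ V.ι) ((g' ⁻¹ᵁ U).ι ≫ p')
      (by simp only [Category.assoc, hf, morphismRestrict_ι_assoc, sq.w]))
    (by simp)

lemma baseChangeHom_restrict (sq : IsPullback g' p' p g) {U V : X.Opens}
    (f : U.toScheme ⟶ V.toScheme) (hf : f ≫ V.ι ≫ p = U.ι ≫ p) :
    baseChangeHom sq f hf ≫ g' ∣_ V = g' ∣_ U ≫ f := by
  simp [baseChangeHom]

lemma baseChangeHom_structure (sq : IsPullback g' p' p g) {U V : X.Opens}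
    (f : U.toScheme ⟶ V.toScheme) (hf : f ≫ V.ι ≫ p = U.ι ≫ p) :
    baseChangeHom sq f hf ≫ (g' ⁻¹ᵁ V).ι ≫ p' = (g' ⁻¹ᵁ U).ι ≫ p' := by
  simp [baseChangeHom]

lemma hom_ext_preimage (sq : IsPullback g' p' p g) {V : X.Opens} {T : Scheme.{u}}
    {a b : T ⟶ (g' ⁻¹ᵁ V).toScheme} (h₁ : a ≫ g' ∣_ V = b ≫ g' ∣_ V)
    (h₂ : a ≫ (g' ⁻¹ᵁ V).ι ≫ p' = b ≫ (g' ⁻¹ᵁ V).ι ≫ p') : a = b := by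
  refine (isPullback_morphismRestrict g' V).hom_ext h₁ (sq.hom_ext ?_ (by simpa using h₂))
  simpa using congr($h₁ ≫ V.ι)

lemma inv_comp_of_hom_comp {U V : X.Opens} (i : U.toScheme ≅ V.toScheme)
    (hi : i.hom ≫ V.ι ≫ p = U.ι ≫ p) : i.inv ≫ U.ι ≫ p = V.ι ≫ p := by
  rw [← hi, Iso.inv_hom_id_assoc]

/-- The base change of an `S`-isomorphism between open subschemes of `X`. -/
@[simps]
def baseChangeIso (sq : IsPullback g' p' p g) {U V : X.Opens} (i : U.toScheme ≅ V.toScheme)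
    (hi : i.hom ≫ V.ι ≫ p = U.ι ≫ p) : (g' ⁻¹ᵁ U).toScheme ≅ (g' ⁻¹ᵁ V).toScheme where
  hom := baseChangeHom sq i.hom hi
  inv := baseChangeHom sq i.inv (inv_comp_of_hom_comp i hi)
  hom_inv_id := hom_ext_preimage sq
    (by rw [Category.assoc, baseChangeHom_restrict,
          reassoc_of% baseChangeHom_restrict sq i.hom hi]; simp)
    (by rw [Category.assoc, baseChangeHom_structure, baseChangeHom_structure]; simp)
  inv_hom_id := hom_ext_preimage sq
    (by rw [Category.assoc, baseChangeHom_restrict,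
          reassoc_of% baseChangeHom_restrict sq i.inv (inv_comp_of_hom_comp i hi)]; simp)
    (by rw [Category.assoc, baseChangeHom_structure, baseChangeHom_structure]; simp)

/-- The base change along `g : S' ⟶ S` of an `S`-isomorphism `e : U ≅ V` between dense open
subschemes of `X`, as an isomorphism between the preimages of `U` and `V` in `X' = X ×_S S'`,
in case these preimages are dense. -/
def baseChange (sq : IsPullback g' p' p g) (e : X.PartialIso X) (he : e.IsOver p p)
    (h₁ : Dense (g' ⁻¹ᵁ e.source : Set X')) (h₂ : Dense (g' ⁻¹ᵁ e.target : Set X')) :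
    X'.PartialIso X' where
  source := g' ⁻¹ᵁ e.source
  dense_source := h₁
  target := g' ⁻¹ᵁ e.target
  dense_target := h₂
  iso := baseChangeIso sq e.iso he

lemma baseChange_isOver (sq : IsPullback g' p' p g) (e : X.PartialIso X) (he : e.IsOver p p)
    (h₁ : Dense (g' ⁻¹ᵁ e.source : Set X')) (h₂ : Dense (g' ⁻¹ᵁ e.target : Set X')) :
    (baseChange sq e he h₁ h₂).IsOver p' p' :=
  baseChangeHom_structure sq e.iso.hom he

end BaseChange


/-! ### Varieties, algebraic families and the Zariski topology -/

section Families

variable {k : Type u} [Field k]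

/-- A variety over `k`: a reduced, separated scheme of finite type over `k`. -/
structure IsVariety {X : Scheme.{u}} (sX : X ⟶ Spec (.of k)) : Prop where
  isReduced : IsReduced X
  isSeparated : IsSeparated sX
  locallyOfFiniteType : LocallyOfFiniteType sX
  quasiCompact : QuasiCompact sX

/-- The `k`-rational points of a `k`-scheme `V`. -/
def RatPoint {V : Scheme.{u}} (sV : V ⟶ Spec (.of k)) : Type u :=
  {v : Spec (.of k) ⟶ V // v ≫ sV = 𝟙 _}

/-- The point of the scheme `V` underlying a `k`-rational point. -/
def RatPoint.point {V : Scheme.{u}} {sV : V ⟶ Spec (.of k)} (v : RatPoint sV) : V :=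
  v.1 (IsLocalRing.closedPoint k)

/-- The Zariski topology on `V(k)`. -/
instance {V : Scheme.{u}} (sV : V ⟶ Spec (.of k)) : TopologicalSpace (RatPoint sV) :=
  TopologicalSpace.induced RatPoint.point inferInstance

/-- An algebraic family of birational transformations of `X` parametrized by `V`: a `V`-birational
map `θ : V × X ⇢ V × X`, inducing an isomorphism between dense open subsets of `V × X`
which both surject onto `V`. -/
structure AlgFamily {V X : Scheme.{u}} (sV : V ⟶ Spec (.of k)) (sX : X ⟶ Spec (.of k)) where
  θ : (pullback sV sX).PartialIso (pullback sV sX)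
  isOver : θ.IsOver (pullback.fst sV sX) (pullback.fst sV sX)
  surjective_source : Surjective (θ.source.ι ≫ pullback.fst sV sX)
  surjective_target : Surjective (θ.target.ι ≫ pullback.fst sV sX)

variable {V X : Scheme.{u}} {sV : V ⟶ Spec (.of k)} {sX : X ⟶ Spec (.of k)}

/-- The inclusion `X ⟶ V × X`, `x ↦ (v, x)`, of the fibre over a rational point `v`. -/
def fibreIncl (sX : X ⟶ Spec (.of k)) (v : RatPoint sV) : X ⟶ pullback sV sX :=
  pullback.lift (sX ≫ v.1) (𝟙 X) (by rw [Category.assoc, v.2, Category.comp_id, Category.id_comp])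

/-- `X` is the fibre of `V × X ⟶ V` over the rational point `v`. -/
lemma isPullback_fibreIncl (v : RatPoint sV) :
    IsPullback (fibreIncl sX v) sX (pullback.fst sV sX) v.1 := by
  refine IsPullback.of_right (h₁₂ := pullback.snd sV sX) (v₁₃ := sX) (h₂₂ := sV) ?_
    (pullback.lift_fst _ _ _) (IsPullback.of_hasPullback sV sX).flip
  have h1 : fibreIncl sX v ≫ pullback.snd sV sX = 𝟙 X := pullback.lift_snd _ _ _
  rw [h1, v.2]
  exact IsPullback.of_horiz_isIso ⟨by simp⟩

lemma dense_fibre [IrreducibleSpace X] (v : RatPoint sV) (U : (pullback sV sX).Opens)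
    (hU : Surjective (U.ι ≫ pullback.fst sV sX)) : Dense (fibreIncl sX v ⁻¹ᵁ U : Set X) := by
  refine (fibreIncl sX v ⁻¹ᵁ U).2.dense ?_
  obtain ⟨u, hu⟩ := hU.surj v.point
  obtain ⟨x, hx, -⟩ := Scheme.exists_preimage_of_isPullback (isPullback_fibreIncl (sX := sX) v)
    u.1 (IsLocalRing.closedPoint k) hu
  refine ⟨x, ?_⟩
  show fibreIncl sX v x ∈ U
  have : fibreIncl sX v x = u.1 := hx
  rw [this]
  exact u.2

/-- The map `ρ_θ : V(k) → Bir(X)`, `v ↦ (x ↦ θ(v, x))`: the transformation `ρ_θ(v)` is the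
restriction of `θ` to the fibre `X` of `V × X` over `v`. -/
def AlgFamily.ρ [IrreducibleSpace X] (F : AlgFamily sV sX) (v : RatPoint sV) : Bir sX :=
  Bir.mk (baseChange (isPullback_fibreIncl v) F.θ F.isOver
      (dense_fibre v _ F.surjective_source) (dense_fibre v _ F.surjective_target))
    (baseChange_isOver _ _ _ _ _)

/-- The Zariski topology on `Bir(X)`: the finest topology such that for all algebraic families
`θ` parametrized by a variety `V` the map `ρ_θ : V(k) → Bir(X)` is continuous. -/
instance zariskiTopology [IrreducibleSpace X] (sX : X ⟶ Spec (.of k)) :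
    TopologicalSpace (Bir sX) :=
  ⨆ (V : Scheme.{u}) (sV : V ⟶ Spec (.of k)) (_ : IsVariety sV) (F : AlgFamily sV sX),
    TopologicalSpace.coinduced F.ρ inferInstance

end Families

/-! ### Pulling back `Y`-birational transformations -/

section Pullback

variable {X S Y T X' : Scheme.{u}} {sX : X ⟶ S} {π : X ⟶ Y} {g' : X' ⟶ X} {p' : X' ⟶ T} {g : T ⟶ Y}

/-- Every element of `Bir(X/Y)` is represented by an isomorphism over `Y` between dense opens. -/
lemma exists_rep [IrreducibleSpace X] [IrreducibleSpace Y] (φ : relBir sX π) :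
    ∃ e : X.PartialIso X, e.IsOver π π ∧ e.toRationalMap = φ.1.1 := by
  obtain ⟨⟨_, e, he, rfl⟩, hφ⟩ := φ
  have hφ : (e.toPartialMap.compHom π).toRationalMap = π.toPartialMap.toRationalMap := hφ
  rw [Scheme.PartialMap.toRationalMap_eq_iff] at hφ
  obtain ⟨W, hW, hW₁, hW₂, h⟩ := hφ
  obtain ⟨U, hU, V, hV, i⟩ := e
  have hW₁ : W ≤ U := hW₁
  have h : X.homOfLE hW₁ ≫ (i.hom ≫ V.ι) ≫ π = X.homOfLE le_top ≫ X.topIso.hom ≫ π := h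
  let f : X.PartialMap X := ⟨W, hW, X.homOfLE hW₁ ≫ i.hom ≫ V.ι⟩
  have : IsOpenImmersion f.hom := inferInstanceAs (IsOpenImmersion (X.homOfLE hW₁ ≫ i.hom ≫ V.ι))
  have : IsDominant f.hom := by
    have := Opens.isDominant_homOfLE hW hW₁
    have := Opens.isDominant_ι hV
    exact inferInstanceAs (IsDominant (X.homOfLE hW₁ ≫ i.hom ≫ V.ι))
  obtain ⟨e, he⟩ := exists_partialIso f
  refine ⟨e, ?_, ?_⟩
  · have key : f.hom ≫ π = f.domain.ι ≫ π := by
      have : (X.homOfLE hW₁ ≫ i.hom ≫ V.ι) ≫ π = W.ι ≫ π := by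
        simpa [X.topIso_hom] using h
      exact this
    rw [← he] at key
    exact (Category.assoc _ _ _).symm.trans key
  · refine (congrArg Scheme.PartialMap.toRationalMap he).trans ?_
    exact Scheme.PartialMap.restrict_toRationalMap ⟨U, hU, i.hom ≫ V.ι⟩ W hW hW₁

/-- The base change of a rational map is compatible with the projection to `X`. -/
lemma baseChange_compHom [IrreducibleSpace X] [IrreducibleSpace X'] [IsDominant g']
    (sq : IsPullback g' p' π g) (e : X.PartialIso X) (he : e.IsOver π π)
    (h₁ : Dense (g' ⁻¹ᵁ e.source : Set X')) (h₂ : Dense (g' ⁻¹ᵁ e.target : Set X')) :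
    (baseChange sq e he h₁ h₂).toRationalMap.compHom g' =
      g'.toRationalMap.comp e.toRationalMap := by
  rw [Scheme.RationalMap.toRationalMap_comp, ← Scheme.RationalMap.compHom_toRationalMap,
    Scheme.PartialMap.toRationalMap_eq_iff]
  obtain ⟨U, hU, V, hV, i⟩ := e
  have hW : (⊤ : X'.Opens).ι ''ᵁ (X'.topIso.hom ≫ g') ⁻¹ᵁ U ≤ g' ⁻¹ᵁ U := by
    rintro _ ⟨x, hx, rfl⟩
    exact hx
  refine ⟨_, Scheme.PartialMap.dense_domain _, hW, le_rfl, ?_⟩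
  have key : X'.homOfLE hW ≫ (baseChangeHom sq i.hom he ≫ (g' ⁻¹ᵁ V).ι) ≫ g' =
      X'.homOfLE le_rfl ≫ (Scheme.Hom.isoImage (⊤ : X'.Opens).ι
        ((X'.topIso.hom ≫ g') ⁻¹ᵁ U)).inv ≫ (X'.topIso.hom ≫ g') ∣_ U ≫ i.hom ≫ V.ι := by
    have h : (baseChangeHom sq i.hom he ≫ (g' ⁻¹ᵁ V).ι) ≫ g' = g' ∣_ U ≫ i.hom ≫ V.ι := by
      rw [Category.assoc, ← morphismRestrict_ι,
        reassoc_of% baseChangeHom_restrict sq i.hom he]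
    rw [h, X'.homOfLE_rfl, Category.id_comp]
    have h' : X'.homOfLE hW ≫ g' ∣_ U = (Scheme.Hom.isoImage (⊤ : X'.Opens).ι
        ((X'.topIso.hom ≫ g') ⁻¹ᵁ U)).inv ≫ (X'.topIso.hom ≫ g') ∣_ U := by
      rw [← cancel_mono U.ι, Category.assoc, Category.assoc, morphismRestrict_ι,
        morphismRestrict_ι, Scheme.Opens.isoImage_ι_inv_ι_assoc, X'.homOfLE_ι_assoc]
      have h3 (A : X'.Opens) : X'.homOfLE (le_top : A ≤ ⊤) ≫ X'.topIso.hom = A.ι := by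
        rw [X'.topIso_hom, X'.homOfLE_ι]
      exact congr($((h3 _).symm) ≫ g')
    rw [reassoc_of% h']
  exact key

/-- A rational map to a fibre product is determined by its two components. -/
lemma eq_of_compHom_eq {Z : Scheme.{u}} (sq : IsPullback g' p' π g) {ψ ψ' : Z ⤏ X'}
    (h₁ : ψ.compHom g' = ψ'.compHom g') (h₂ : ψ.compHom p' = ψ'.compHom p') : ψ = ψ' := by
  obtain ⟨a, rfl⟩ := ψ.exists_rep
  obtain ⟨b, rfl⟩ := ψ'.exists_rep
  rw [← Scheme.RationalMap.compHom_toRationalMap, ← Scheme.RationalMap.compHom_toRationalMap,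
    Scheme.PartialMap.toRationalMap_eq_iff] at h₁ h₂
  obtain ⟨W₁, hW₁, l₁, r₁, e₁⟩ := h₁
  obtain ⟨W₂, hW₂, l₂, r₂, e₂⟩ := h₂
  obtain ⟨A, hA, a⟩ := a
  obtain ⟨B, hB, b⟩ := b
  have l₁ : W₁ ≤ A := l₁
  have r₁ : W₁ ≤ B := r₁
  have l₂ : W₂ ≤ A := l₂
  have r₂ : W₂ ≤ B := r₂
  have e₁ : Z.homOfLE l₁ ≫ a ≫ g' = Z.homOfLE r₁ ≫ b ≫ g' := e₁
  have e₂ : Z.homOfLE l₂ ≫ a ≫ p' = Z.homOfLE r₂ ≫ b ≫ p' := e₂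
  rw [Scheme.PartialMap.toRationalMap_eq_iff]
  refine ⟨W₁ ⊓ W₂, hW₁.inter_of_isOpen_left hW₂ W₁.2, inf_le_left.trans l₁,
    inf_le_left.trans r₁, ?_⟩
  have key : Z.homOfLE (inf_le_left.trans l₁ : W₁ ⊓ W₂ ≤ A) ≫ a =
      Z.homOfLE (inf_le_left.trans r₁ : W₁ ⊓ W₂ ≤ B) ≫ b := by
    refine sq.hom_ext ?_ ?_
    · simpa using congr(Z.homOfLE (inf_le_left : W₁ ⊓ W₂ ≤ W₁) ≫ $e₁)
    · simpa using congr(Z.homOfLE (inf_le_right : W₁ ⊓ W₂ ≤ W₂) ≫ $e₂)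
  exact key

lemma compHom_eq_of_bir {ψ : X' ⤏ X'} (h : ∃ e : X'.PartialIso X', e.IsOver p' p' ∧
    e.toRationalMap = ψ) : ψ.compHom p' = p'.toRationalMap := by
  obtain ⟨e, he, rfl⟩ := h
  rw [← Scheme.RationalMap.compHom_toRationalMap, Scheme.PartialMap.toRationalMap_eq_iff]
  refine ⟨_, e.dense_source, le_rfl, le_top, ?_⟩
  obtain ⟨U, hU, V, hV, i⟩ := e
  have he : i.hom ≫ V.ι ≫ p' = U.ι ≫ p' := he
  have key : X'.homOfLE le_rfl ≫ (i.hom ≫ V.ι) ≫ p' =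
      X'.homOfLE (le_top : U ≤ ⊤) ≫ X'.topIso.hom ≫ p' := by
    simp [he]
  exact key

variable [IrreducibleSpace X] [IrreducibleSpace Y] [IrreducibleSpace X']

lemma dense_preimage (g' : X' ⟶ X) [IsDominant g'] (U : X.Opens) (hU : Dense (U : Set X)) :
    Dense (g' ⁻¹ᵁ U : Set X') := by
  refine (g' ⁻¹ᵁ U).2.dense ?_
  obtain ⟨_, hx, y, rfl⟩ := g'.denseRange.inter_open_nonempty _ U.2 hU.nonempty
  exact ⟨y, hx⟩

/-- For a cartesian square with `X' = X ×_Y T` irreducible and dominating `X`, the homomorphism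
`Bir(X/Y) → Bir_T(X')` which maps `φ` to its base change along `T ⟶ Y`: if `φ` is represented by
the `Y`-isomorphism `e : U ≅ V`, then its image is represented by `U ×_Y T ≅ V ×_Y T`. -/
def pullbackBir (sX : X ⟶ S) [IsDominant g'] (sq : IsPullback g' p' π g) :
    relBir sX π →* Bir p' :=
  let ε (φ : relBir sX π) : Bir p' :=
    Bir.mk (baseChange sq (exists_rep φ).choose (exists_rep φ).choose_spec.1
      (dense_preimage g' _ (Scheme.PartialIso.dense_source _))
      (dense_preimage g' _ (Scheme.PartialIso.dense_target _))) (baseChange_isOver _ _ _ _ _)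
  have hε (φ) : (ε φ).1.compHom g' = g'.toRationalMap.comp φ.1.1 :=
    (baseChange_compHom sq _ _ _ _).trans (comp_congr rfl (exists_rep φ).choose_spec.2)
  MonoidHom.mk' ε fun φ ψ ↦ Bir.ext <| eq_of_compHom_eq sq
    (by
      have h : (ε φ * ε ψ).1.compHom g' = g'.toRationalMap.comp (φ * ψ).1.1 := by
        rw [Bir.mul_val, ← Scheme.RationalMap.comp_toRationalMap, Scheme.RationalMap.comp_assoc,
          Scheme.RationalMap.comp_toRationalMap, hε, ← Scheme.RationalMap.comp_assoc]
        have h1 : (ε ψ).1.comp g'.toRationalMap = g'.toRationalMap.comp ψ.1.1 := by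
          rw [Scheme.RationalMap.comp_toRationalMap, hε]
        exact (comp_congr h1 rfl).trans (Scheme.RationalMap.comp_assoc _ _ _)
      exact (hε _).trans h.symm)
    ((compHom_eq_of_bir (ε (φ * ψ)).2).trans (compHom_eq_of_bir (ε φ * ε ψ).2).symm)

/-- The pull-back does not depend on the choice of the representing isomorphism. -/
lemma pullbackBir_eq (sX : X ⟶ S) [IsDominant g'] (sq : IsPullback g' p' π g)
    (φ : relBir sX π) (e : X.PartialIso X) (he : e.IsOver π π) (hφ : e.toRationalMap = φ.1.1) :
    pullbackBir sX sq φ = Bir.mk (baseChange sq e he (dense_preimage g' _ e.dense_source)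
      (dense_preimage g' _ e.dense_target)) (baseChange_isOver _ _ _ _ _) := by
  refine Bir.ext (eq_of_compHom_eq sq ?_
    ((compHom_eq_of_bir (pullbackBir sX sq φ).2).trans
      (compHom_eq_of_bir ⟨_, baseChange_isOver _ _ _ _ _, rfl⟩).symm))
  refine (baseChange_compHom sq _ _ _ _).trans ?_
  refine Eq.trans ?_ (baseChange_compHom sq _ _ _ _).symm
  exact comp_congr rfl ((exists_rep φ).choose_spec.2.trans hφ.symm)

end Pullback

/-! ### The geometric generic fibre -/

section GeometricGenericFibre

variable {X Y : Scheme.{u}} [IsIntegral Y] (π : X ⟶ Y)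
  (K : Type u) [Field K] [Algebra Y.functionField K]

/-- The geometric generic point `Spec K ⟶ Spec k(Y) ⟶ Y`. -/
def geomGenericPoint (Y : Scheme.{u}) [IsIntegral Y] (K : Type u) [Field K]
    [Algebra Y.functionField K] : Spec (.of K) ⟶ Y :=
  Spec.map (CommRingCat.ofHom (algebraMap Y.functionField K)) ≫ Y.fromSpecStalk (genericPoint Y)

/-- The geometric generic fibre `X_K` of `π`, the pull-back of `π` along `Spec K ⟶ Y`. -/
abbrev geomGenericFibre : Scheme.{u} := pullback π (geomGenericPoint Y K)

/-- The structure morphism `X_K ⟶ Spec K`. -/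
abbrev geomGenericFibreStr : geomGenericFibre π K ⟶ Spec (.of K) :=
  pullback.snd π (geomGenericPoint Y K)

lemma geomGenericPoint_apply (x : Spec (.of K)) : geomGenericPoint Y K x = genericPoint Y := by
  have hx : geomGenericPoint Y K x = Y.fromSpecStalk (genericPoint Y)
    (Spec.map (CommRingCat.ofHom (algebraMap Y.functionField K)) x) := rfl
  have : geomGenericPoint Y K x ∈ Set.range (Y.fromSpecStalk (genericPoint Y)) := ⟨_, hx.symm⟩
  rw [Scheme.range_fromSpecStalk] at this
  exact (this.antisymm (genericPoint_specializes _)).eq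

/-- The geometric generic fibre of a dominant morphism dominates `X`. -/
instance isDominant_fst [IrreducibleSpace X] [IsDominant π] :
    IsDominant (pullback.fst π (geomGenericPoint Y K)) := by
  have hgen : π (genericPoint X) = genericPoint Y := by
    have h := (genericPoint_spec X).image π.continuous
    rw [Set.image_univ, π.denseRange.closure_range] at h
    exact h.eq (genericPoint_spec Y)
  obtain ⟨z, hz, -⟩ := Scheme.Pullback.exists_preimage_pullback (f := π)
    (g := geomGenericPoint Y K) (genericPoint X) (IsLocalRing.closedPoint K)
    (hgen.trans (geomGenericPoint_apply K _).symm)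
  refine ⟨fun x ↦ ?_⟩
  have h : {genericPoint X} ⊆ Set.range (pullback.fst π (geomGenericPoint Y K)) :=
    Set.singleton_subset_iff.mpr ⟨z, hz⟩
  refine closure_mono h ?_
  rw [genericPoint_closure]
  trivial

/-- The homomorphism `Bir(X/Y) → Bir_K(X_K)`, `φ ↦ φ_K`, obtained by base change. -/
def geomPullback {S : Scheme.{u}} (sX : X ⟶ S) [IrreducibleSpace X] [IsDominant π]
    [IrreducibleSpace (geomGenericFibre π K)] :
    relBir sX π →* Bir (geomGenericFibreStr π K) :=
  pullbackBir sX (IsPullback.of_hasPullback π (geomGenericPoint Y K))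

end GeometricGenericFibre

end BirationalFamilies

end

/-!
# Base change of relative birational transformations to the geometric generic fibre

*Injectivity.* The projection `X_K ⟶ X` is dominant and `X` is reduced and separated, so a rational
map from `X` to itself is determined by its composition with this projection, and that composition
is read off from the base change to `X_K` (`pullbackBir_injective`).

*Continuity.* Let `C` be a closed subset of `Bir_K(X_K)`. The set of all `φ` in `Bir(X/Y)` with
`φ_K ∈ C` is in fact closed in `Bir(X)`. To see this, let `θ` be a family of birational
transformations of `X` parametrized by a variety `V`.

The points of the source of `θ` at which `(v, x) ↦ π(x)` and `π ∘ pr₂ ∘ θ` differ form an open set,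
because `Y` is separated. Its image `N` in `V` is open, and a member `ρ_θ(v)` belongs to `Bir(X/Y)`
if and only if `v ∉ N` (`ρ_mem_relBir_iff`). Let `W` be the reduced closed subscheme `V \ N`. Since
`k` is algebraically closed, `W × X` is reduced (`isReduced_pullback`), so the restriction of `θ` to
`W × X` is a morphism over `W × Y` (`comap_isOver_snd`).

A family over `W × Y` can be base changed along `W × Spec K ⟶ W × Y`; this gives a partial
isomorphism of `W_K ×_K X_K`. Its source and target need not surject onto `W_K`, but their images
are open and contain the `K`-points which come from `W(k)`, because `X_K` dominates `X`. So there is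
an algebraic family `G` of birational transformations of `X_K` over an open subset `O` of `W_K`
whose members at the points of `W(k)` are the base changes of the members of `θ`
(`exists_family_geomGenericFibre`). The map `W(k) → O(K)` is continuous although it is not induced
by a morphism of schemes: the projection `W_K ⟶ W` is open and has a single point over every point
of `W(k)` (`RatPoint.continuous_point_baseExtend`). So the parameters in `W(k)` whose members are
mapped into `C` form a closed set, the preimage of `ρ_G⁻¹(C)` (`isClosed_setOf_geomPullback_mem`).
-/

namespace BirationalFamilies

/-! ### Products of reduced varieties -/

section Reduced

open TensorProduct

lemma exists_algHom_ker_eq (k : Type*) {A : Type*} [Field k] [IsAlgClosed k] [CommRing A]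
    [Algebra k A] [Algebra.FiniteType k A] (m : Ideal A) [m.IsMaximal] :
    ∃ f : A →ₐ[k] k, RingHom.ker f = m := by
  let := Ideal.Quotient.field m
  have : Algebra.FiniteType k (A ⧸ m) := inferInstance
  have : Module.Finite k (A ⧸ m) := finite_of_finite_type_of_isJacobsonRing k (A ⧸ m)
  let e : k ≃ₐ[k] A ⧸ m := AlgEquiv.ofBijective (Algebra.ofId k (A ⧸ m))
    IsAlgClosed.algebraMap_bijective_of_isIntegral
  refine ⟨e.symm.toAlgHom.comp (Ideal.Quotient.mkₐ k m), ?_⟩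
  ext x
  simp [RingHom.mem_ker, Ideal.Quotient.eq_zero_iff_mem]

/-- Expand a nilpotent element as `∑ aᵢ ⊗ bᵢ` in a basis `(bᵢ)` of `B`. Specializing at a maximal
ideal of `A`, whose residue field is `k`, gives a nilpotent element `∑ aᵢ(m) bᵢ` of `B`, so all
`aᵢ` vanish at all closed points of `Spec A`. -/
lemma isReduced_tensorProduct (k A B : Type*) [Field k] [IsAlgClosed k] [CommRing A] [CommRing B]
    [Algebra k A] [Algebra k B] [Algebra.FiniteType k A] [_root_.IsReduced A]
    [_root_.IsReduced B] : _root_.IsReduced (A ⊗[k] B) := by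
  refine ⟨fun x hx ↦ ?_⟩
  let b := Module.Free.chooseBasis k B
  let bA := Algebra.TensorProduct.basis A b
  have key (f : A →ₐ[k] k) (i) : f (bA.repr x i) = 0 := by
    let F : A ⊗[k] B →ₐ[k] B :=
      Algebra.TensorProduct.lift ((Algebra.ofId k B).comp f) (AlgHom.id k B)
        (fun _ _ ↦ Commute.all _ _)
    have hF (y : A ⊗[k] B) (i) : b.repr (F y) i = f (bA.repr y i) := by
      induction y with
      | zero => simp
      | add y z hy hz => simp [hy, hz]
      | tmul a c =>
        have : F (a ⊗ₜ c) = f a • c := by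
          simp [F, Algebra.ofId_apply, Algebra.smul_def]
        rw [this]
        simp [bA, Algebra.TensorProduct.basis_repr_tmul]
    have h0 : F x = 0 := (hx.map F).eq_zero
    rw [← hF, h0]
    simp
  have hzero : bA.repr x = 0 := by
    ext i
    have hJ : IsJacobsonRing A := isJacobsonRing_of_finiteType (A := k)
    have hmem : bA.repr x i ∈ (⊥ : Ideal A).jacobson := by
      refine Ideal.mem_sInf.mpr fun {m} ⟨_, _⟩ ↦ ?_
      obtain ⟨f, rfl⟩ := exists_algHom_ker_eq k m
      exact key f i
    rw [IsJacobsonRing.out hJ (Ideal.isRadical_bot)] at hmem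
    simpa using hmem
  simpa using hzero

lemma isReduced_pullback_of_affine {k : Type u} [Field k] [IsAlgClosed k] {A B : CommRingCat.{u}}
    (f : Spec A ⟶ Spec (.of k)) (g : Spec B ⟶ Spec (.of k)) [hA : IsReduced (Spec A)]
    [hf : LocallyOfFiniteType f] [hB : IsReduced (Spec B)] : IsReduced (pullback f g) := by
  obtain ⟨φ, rfl⟩ := Spec.map_surjective f
  obtain ⟨ψ, rfl⟩ := Spec.map_surjective g
  have hφ : φ.hom.FiniteType := (HasRingHomProperty.Spec_iff (P := @LocallyOfFiniteType)).mp hf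
  have : _root_.IsReduced A := (affine_isReduced_iff A).mp hA
  have : _root_.IsReduced B := (affine_isReduced_iff B).mp hB
  let : Algebra k A := φ.hom.toAlgebra
  let : Algebra k B := ψ.hom.toAlgebra
  have : Algebra.FiniteType k A := hφ
  have := isReduced_tensorProduct k A B
  exact isReduced_of_isOpenImmersion (pullbackSpecIso k A B).hom

/-- The product of two reduced schemes over an algebraically closed field, one of them locally
of finite type, is reduced. -/
lemma isReduced_pullback {k : Type u} [Field k] [IsAlgClosed k] {X Y : Scheme.{u}}
    (f : X ⟶ Spec (.of k)) (g : Y ⟶ Spec (.of k)) [IsReduced X] [LocallyOfFiniteType f]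
    [IsReduced Y] : IsReduced (pullback f g) := by
  apply +allowSynthFailures @IsReduced.of_openCover
    (𝒰 := Scheme.Pullback.openCoverOfLeftRight X.affineCover Y.affineCover f g)
  rintro ⟨i, j⟩
  have h₁ : LocallyOfFiniteType (X.affineCover.f i ≫ f) := inferInstance
  have h₂ : IsReduced (X.affineCover.X i) := inferInstance
  have h₃ : IsReduced (Y.affineCover.X j) := inferInstance
  exact isReduced_pullback_of_affine (A := X.affineOpenCover.X i) (B := Y.affineOpenCover.X j)
    (hA := h₂) (hB := h₃) (X.affineCover.f i ≫ f) (hf := h₁) (Y.affineCover.f j ≫ g)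

end Reduced

/-- A morphism from a reduced scheme which maps set-theoretically into a closed subscheme
factors through it. -/
lemma exists_lift_of_range_subset {T U E : Scheme.{u}} [IsReduced T] (i : E ⟶ U)
    [IsClosedImmersion i] (t : T ⟶ U) (h : Set.range t ⊆ Set.range i) : ∃ l, l ≫ i = t := by
  have : Surjective (pullback.fst t i) := ⟨fun x ↦ by
    obtain ⟨y, hy⟩ := h ⟨x, rfl⟩
    obtain ⟨z, hz, -⟩ := Scheme.Pullback.exists_preimage_pullback x y hy.symm
    exact ⟨z, hz⟩⟩
  have := isIso_of_isClosedImmersion_of_surjective (pullback.fst t i)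
  exact ⟨inv (pullback.fst t i) ≫ pullback.snd t i, by
    rw [Category.assoc, ← pullback.condition, IsIso.inv_hom_id_assoc]⟩

lemma comp_eq_of_range_subset_equalizer {T U Y : Scheme.{u}} [IsReduced T] [Y.IsSeparated]
    (a b : U ⟶ Y) (t : T ⟶ U) (h : Set.range t ⊆ Set.range (equalizer.ι a b)) :
    t ≫ a = t ≫ b := by
  obtain ⟨l, rfl⟩ := exists_lift_of_range_subset _ t h
  rw [Category.assoc, Category.assoc, equalizer.condition]

lemma range_subset_range_equalizer {T U Y : Scheme.{u}} (a b : U ⟶ Y) (t : T ⟶ U)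
    (h : t ≫ a = t ≫ b) : Set.range t ⊆ Set.range (equalizer.ι a b) := by
  rintro _ ⟨x, rfl⟩
  exact ⟨equalizer.lift t h x, by rw [← Scheme.Hom.comp_apply, equalizer.lift_ι]⟩

/-- The reduced induced closed subscheme structure on a closed subset. -/
lemma exists_reduced_closed_subscheme {V : Scheme.{u}} {Z : Set V} (hZ : IsClosed Z) :
    ∃ (W : Scheme.{u}) (i : W ⟶ V), IsReduced W ∧ IsClosedImmersion i ∧ Set.range i = Z := by
  let I := Scheme.IdealSheafData.vanishingIdeal ⟨Z, hZ⟩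
  refine ⟨I.subscheme, I.subschemeι, ?_, inferInstance, ?_⟩
  · apply +allowSynthFailures @IsReduced.of_openCover (𝒰 := I.subschemeCover.openCover)
    intro (U : V.affineOpens)
    have : (I.ideal U).IsRadical := by
      rw [Scheme.IdealSheafData.vanishingIdeal_ideal]
      exact PrimeSpectrum.isRadical_vanishingIdeal _
    have : _root_.IsReduced (Γ(V, U.1) ⧸ I.ideal U) :=
      (Ideal.isRadical_iff_quotient_reduced _).mp this
    change IsReduced (Spec (.of (Γ(V, U.1) ⧸ I.ideal U)))
    infer_instance
  · rw [Scheme.IdealSheafData.range_subschemeι]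
    exact Scheme.IdealSheafData.coe_support_vanishingIdeal _

lemma isSeparated_of_isSeparated_over_affine {Y S : Scheme.{u}} [IsAffine S] (s : Y ⟶ S)
    [IsSeparated s] : Y.IsSeparated := by
  refine ⟨?_⟩
  rw [← terminal.comp_from s]
  infer_instance

/-! ### Transitivity of base change -/

section BaseChange

variable {X X' X'' S S' R R' R'' : Scheme.{u}}

lemma baseChangeIso_baseChangeIso {g' : X' ⟶ X} {p' : X' ⟶ S'} {p : X ⟶ S} {g : S' ⟶ S}
    {g'' : X'' ⟶ X'} {p'' : X'' ⟶ R''} {q : X' ⟶ R'} {h : R'' ⟶ R'}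
    {r : X ⟶ R} {l : R'' ⟶ R}
    (sq : IsPullback g' p' p g) (sq' : IsPullback g'' p'' q h)
    (sq'' : IsPullback (g'' ≫ g') p'' r l) {U V : X.Opens} (i : U.toScheme ≅ V.toScheme)
    (hi : i.hom ≫ V.ι ≫ p = U.ι ≫ p)
    (hi' : (baseChangeIso sq i hi).hom ≫ (g' ⁻¹ᵁ V).ι ≫ q = (g' ⁻¹ᵁ U).ι ≫ q)
    (hi'' : i.hom ≫ V.ι ≫ r = U.ι ≫ r) :
    baseChangeIso sq' (baseChangeIso sq i hi) hi' = baseChangeIso sq'' i hi'' := by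
  ext1
  refine hom_ext_preimage sq'' ?_ ?_
  · have h1 := baseChangeHom_restrict sq' _ hi'
    have h2 := baseChangeHom_restrict sq _ hi
    refine Eq.trans ?_ (baseChangeHom_restrict sq'' _ hi'').symm
    have h4 : (g'' ≫ g') ∣_ V = (g'' ∣_ (g' ⁻¹ᵁ V)) ≫ g' ∣_ V := morphismRestrict_comp _ _ _
    have h5 : (g'' ≫ g') ∣_ U = (g'' ∣_ (g' ⁻¹ᵁ U)) ≫ g' ∣_ U := morphismRestrict_comp _ _ _
    have h6 : baseChangeHom sq' (baseChangeIso sq i hi).hom hi' ≫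
        (g'' ∣_ (g' ⁻¹ᵁ V)) ≫ g' ∣_ V = ((g'' ∣_ (g' ⁻¹ᵁ U)) ≫ g' ∣_ U) ≫ i.hom := by
      rw [reassoc_of% h1, baseChangeIso_hom, h2, Category.assoc]
    exact (congrArg (baseChangeHom sq' (baseChangeIso sq i hi).hom hi' ≫ ·) h4).trans
      (h6.trans (congrArg (· ≫ i.hom) h5.symm))
  · exact (baseChangeHom_structure sq' _ hi').trans (baseChangeHom_structure sq'' _ hi'').symm

/-- Base change is transitive. The two steps may use different structure morphisms on the
intermediate scheme `X'`. -/
lemma baseChange_baseChange {g' : X' ⟶ X} {p' : X' ⟶ S'} {p : X ⟶ S} {g : S' ⟶ S}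
    {g'' : X'' ⟶ X'} {p'' : X'' ⟶ R''} {q : X' ⟶ R'} {h : R'' ⟶ R'}
    {r : X ⟶ R} {l : R'' ⟶ R}
    (sq : IsPullback g' p' p g) (sq' : IsPullback g'' p'' q h)
    (sq'' : IsPullback (g'' ≫ g') p'' r l)
    (e : X.PartialIso X) (he : e.IsOver p p) (h₁ h₂)
    (he' : (baseChange sq e he h₁ h₂).IsOver q q) (h₃ h₄) (her : e.IsOver r r) (h₅ h₆) :
    baseChange sq' (baseChange sq e he h₁ h₂) he' h₃ h₄ = baseChange sq'' e her h₅ h₆ :=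
  congrArg (Scheme.PartialIso.mk _ h₅ _ h₆)
    (baseChangeIso_baseChangeIso sq sq' sq'' e.iso he he' her)

end BaseChange

/-! ### Base change of algebraic families -/

section Families

variable {k : Type u} [Field k]

lemma RatPoint.apply_eq_point {V : Scheme.{u}} {sV : V ⟶ Spec (.of k)} (v : RatPoint sV)
    (x : Spec (.of k)) : v.1 x = v.point :=
  congrArg v.1 (Subsingleton.elim x _)

variable {V X : Scheme.{u}} {sV : V ⟶ Spec (.of k)} {sX : X ⟶ Spec (.of k)}

lemma exists_fibreIncl_eq (v : RatPoint sV) (u : ↥(pullback sV sX))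
    (hu : pullback.fst sV sX u = v.point) : ∃ x, fibreIncl sX v x = u := by
  obtain ⟨x, hx, -⟩ := Scheme.exists_preimage_of_isPullback (isPullback_fibreIncl (sX := sX) v)
    u (IsLocalRing.closedPoint k) hu
  exact ⟨x, hx⟩

lemma fst_fibreIncl (v : RatPoint sV) (x : X) :
    pullback.fst sV sX (fibreIncl sX v x) = v.point := by
  rw [← Scheme.Hom.comp_apply]
  have : fibreIncl sX v ≫ pullback.fst sV sX = sX ≫ v.1 := pullback.lift_fst _ _ _
  rw [this, Scheme.Hom.comp_apply, v.apply_eq_point]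

lemma exists_ratPoint_mem [IsAlgClosed k] [LocallyOfFiniteType sV] (U : Set V) (hU : IsOpen U)
    (hne : U.Nonempty) : ∃ v : RatPoint sV, v.point ∈ U := by
  have : JacobsonSpace V := LocallyOfFiniteType.jacobsonSpace sV
  have hd : Dense (closedPoints V) := by
    rw [dense_iff_closure_eq, closure_closedPoints]
  obtain ⟨x, hx, hx'⟩ := hd.inter_open_nonempty U hU hne
  refine ⟨⟨pointOfClosedPoint sV x hx', pointOfClosedPoint_comp sV x hx'⟩, ?_⟩
  have : RatPoint.point (sV := sV) ⟨pointOfClosedPoint sV x hx', pointOfClosedPoint_comp sV x hx'⟩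
    = x := pointOfClosedPoint_apply sV x hx' _
  rwa [this]

/-- An open subset of `V × X` which surjects onto `V` is dense: its fibres over the rational
points of `V` are dense in `X`, and `V × X ⟶ V` is open. -/
lemma dense_of_surjective [IsAlgClosed k] [LocallyOfFiniteType sV] [IrreducibleSpace X]
    (U : (pullback sV sX).Opens) (hU : Surjective (U.ι ≫ pullback.fst sV sX)) :
    Dense (U : Set ↥(pullback sV sX)) := by
  rw [dense_iff_inter_open]
  intro Ω hΩ hne
  obtain ⟨v, u, hu, huv⟩ := exists_ratPoint_mem (sV := sV) (pullback.fst sV sX '' Ω)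
    ((pullback.fst sV sX).isOpenMap _ hΩ) (hne.image _)
  obtain ⟨x, rfl⟩ := exists_fibreIncl_eq v u huv
  obtain ⟨y, hy, hy'⟩ := (dense_fibre v U hU).inter_open_nonempty (fibreIncl sX v ⁻¹' Ω)
    (hΩ.preimage (fibreIncl sX v).continuous) ⟨x, hu⟩
  exact ⟨fibreIncl sX v y, hy, hy'⟩

/-- The pull-back of an algebraic family along a cartesian square `V' × X' ⟶ V × X` over
`V' ⟶ B`, where the family is a family of `B`-morphisms. The ground field may change. -/
noncomputable def AlgFamily.ofIsPullback {k' : Type u} [Field k'] [IsAlgClosed k'] {V' X' B : Scheme.{u}}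
    {sV' : V' ⟶ Spec (.of k')} {sX' : X' ⟶ Spec (.of k')} [LocallyOfFiniteType sV']
    [IrreducibleSpace X'] (F : AlgFamily sV sX) {j : pullback sV' sX' ⟶ pullback sV sX}
    {m : pullback sV sX ⟶ B} {g : V' ⟶ B} (sq : IsPullback j (pullback.fst sV' sX') m g)
    (hF : F.θ.IsOver m m)
    (hs : Surjective ((j ⁻¹ᵁ F.θ.source).ι ≫ pullback.fst sV' sX'))
    (ht : Surjective ((j ⁻¹ᵁ F.θ.target).ι ≫ pullback.fst sV' sX')) : AlgFamily sV' sX' where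
  θ := baseChange sq F.θ hF (dense_of_surjective _ hs) (dense_of_surjective _ ht)
  isOver := baseChange_isOver _ _ _ _ _
  surjective_source := hs
  surjective_target := ht

/-- A member of a pulled back family is the base change of the partial isomorphism `θ` of `V × X`
along the composition `f` of the inclusion of the fibre with `V' × X' ⟶ V × X`. The base `C` over
which `f` is presented as a base change may differ from the bases `B` and `V`. -/
lemma AlgFamily.ρ_ofIsPullback {k' : Type u} [Field k'] [IsAlgClosed k'] {V' X' B : Scheme.{u}}
    {sV' : V' ⟶ Spec (.of k')} {sX' : X' ⟶ Spec (.of k')} [LocallyOfFiniteType sV']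
    [IrreducibleSpace X'] (F : AlgFamily sV sX) {j : pullback sV' sX' ⟶ pullback sV sX}
    {m : pullback sV sX ⟶ B} {g : V' ⟶ B} (sq : IsPullback j (pullback.fst sV' sX') m g)
    (hF : F.θ.IsOver m m) (hs ht) (v : RatPoint sV') {C : Scheme.{u}} {r : pullback sV sX ⟶ C}
    {l : Spec (.of k') ⟶ C} {f : X' ⟶ pullback sV sX} (sq' : IsPullback f sX' r l)
    (hf : fibreIncl sX' v ≫ j = f) (hr : F.θ.IsOver r r) (h₁ h₂) :
    (F.ofIsPullback sq hF hs ht).ρ v =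
      Bir.mk (baseChange sq' F.θ hr h₁ h₂) (baseChange_isOver _ _ _ _ _) := by
  subst hf
  refine Bir.ext (congrArg Scheme.PartialIso.toRationalMap ?_)
  exact baseChange_baseChange sq (isPullback_fibreIncl v) sq' F.θ hF _ _ _ _ _ hr h₁ h₂

lemma surjective_preimage {T A V' V : Scheme.{u}} {j : T ⟶ A} {p' : T ⟶ V'} {p : A ⟶ V}
    {i : V' ⟶ V} (sq : IsPullback j p' p i) (U : A.Opens) (hU : Set.range i ⊆ p '' U) :
    Surjective ((j ⁻¹ᵁ U).ι ≫ p') := by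
  refine ⟨fun w ↦ ?_⟩
  obtain ⟨u, hu, hu'⟩ := hU ⟨w, rfl⟩
  obtain ⟨t, rfl, rfl⟩ := Scheme.exists_preimage_of_isPullback sq u w hu'
  exact ⟨⟨t, hu⟩, rfl⟩

lemma image_eq_univ_of_surjective {A V : Scheme.{u}} {p : A ⟶ V} (U : A.Opens)
    (hU : Surjective (U.ι ≫ p)) : p '' U = Set.univ := by
  refine Set.eq_univ_of_forall fun v ↦ ?_
  obtain ⟨u, rfl⟩ := hU.surj v
  exact ⟨u.1, u.2, rfl⟩

section ProdMap

variable {k' : Type u} [Field k'] {V' X' : Scheme.{u}} {sV' : V' ⟶ Spec (.of k')}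
  {sX' : X' ⟶ Spec (.of k')} {t : Spec (.of k') ⟶ Spec (.of k)}

/-- The product `V' × X' ⟶ V × X` of two morphisms over a morphism of base fields. -/
noncomputable def prodMap {c : V' ⟶ V} {f : X' ⟶ X} (hc : c ≫ sV = sV' ≫ t)
    (hf : f ≫ sX = sX' ≫ t) :
    pullback sV' sX' ⟶ pullback sV sX :=
  pullback.lift (pullback.fst sV' sX' ≫ c) (pullback.snd sV' sX' ≫ f) (by
    rw [Category.assoc, Category.assoc, hc, hf, pullback.condition_assoc])

variable {c : V' ⟶ V} {f : X' ⟶ X} (hc : c ≫ sV = sV' ≫ t) (hf : f ≫ sX = sX' ≫ t)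

lemma prodMap_fst : prodMap hc hf ≫ pullback.fst sV sX = pullback.fst sV' sX' ≫ c :=
  pullback.lift_fst _ _ _

lemma prodMap_snd : prodMap hc hf ≫ pullback.snd sV sX = pullback.snd sV' sX' ≫ f :=
  pullback.lift_snd _ _ _

lemma fibreIncl_prodMap (v' : RatPoint sV') (v : RatPoint sV) (hv : v'.1 ≫ c = t ≫ v.1) :
    fibreIncl sX' v' ≫ prodMap hc hf = f ≫ fibreIncl sX v := by
  have h₁ : fibreIncl sX' v' ≫ pullback.fst sV' sX' = sX' ≫ v'.1 := pullback.lift_fst _ _ _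
  have h₂ : fibreIncl sX' v' ≫ pullback.snd sV' sX' = 𝟙 X' := pullback.lift_snd _ _ _
  have h₃ : fibreIncl sX v ≫ pullback.fst sV sX = sX ≫ v.1 := pullback.lift_fst _ _ _
  have h₄ : fibreIncl sX v ≫ pullback.snd sV sX = 𝟙 X := pullback.lift_snd _ _ _
  apply pullback.hom_ext
  · rw [Category.assoc, Category.assoc, prodMap_fst, reassoc_of% h₁, h₃, hv, reassoc_of% hf]
  · rw [Category.assoc, Category.assoc, prodMap_snd, reassoc_of% h₂, h₄, Category.comp_id]

end ProdMap

/-- `W × X` is the base change of `V × X ⟶ V` along `W ⟶ V`. -/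
lemma isPullback_prodMap_id {W : Scheme.{u}} {i : W ⟶ V} {sW : W ⟶ Spec (.of k)}
    (hi : i ≫ sV = sW ≫ 𝟙 _) :
    IsPullback (prodMap hi (by simp : 𝟙 X ≫ sX = sX ≫ 𝟙 _))
      (pullback.fst sW sX) (pullback.fst sV sX) i := by
  refine IsPullback.of_right (h₁₂ := pullback.snd sV sX) (v₁₃ := sX) (h₂₂ := sV) ?_
    (prodMap_fst _ _) (IsPullback.of_hasPullback sV sX).flip
  rw [prodMap_snd, hi, Category.comp_id, Category.comp_id]
  exact (IsPullback.of_hasPullback sW sX).flip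

/-- The pull-back of an algebraic family along a morphism of parameter spaces. -/
noncomputable def AlgFamily.comap [IsAlgClosed k] [IrreducibleSpace X] (F : AlgFamily sV sX)
    {W : Scheme.{u}} (i : W ⟶ V) {sW : W ⟶ Spec (.of k)} [LocallyOfFiniteType sW]
    (hi : i ≫ sV = sW ≫ 𝟙 _) : AlgFamily sW sX :=
  F.ofIsPullback (isPullback_prodMap_id hi) F.isOver
    (surjective_preimage (isPullback_prodMap_id hi) _
      (by rw [image_eq_univ_of_surjective _ F.surjective_source]; exact Set.subset_univ _))
    (surjective_preimage (isPullback_prodMap_id hi) _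
      (by rw [image_eq_univ_of_surjective _ F.surjective_target]; exact Set.subset_univ _))

lemma AlgFamily.ρ_comap [IsAlgClosed k] [IrreducibleSpace X] (F : AlgFamily sV sX)
    {W : Scheme.{u}} (i : W ⟶ V) {sW : W ⟶ Spec (.of k)} [LocallyOfFiniteType sW]
    (hi : i ≫ sV = sW ≫ 𝟙 _) (w : RatPoint sW) (v : RatPoint sV) (hv : w.1 ≫ i = v.1) :
    (F.comap i hi).ρ w = F.ρ v :=
  F.ρ_ofIsPullback _ _ _ _ w (isPullback_fibreIncl v)
    ((fibreIncl_prodMap _ _ w v (by simp [hv])).trans (Category.id_comp _)) _ _ _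

end Families

/-! ### Families of relative birational transformations -/

section NotOverLocus

variable {A Z : Scheme.{u}}

/-- The points of the source of `e` outside the equalizer of the morphisms `q` and `q ∘ e` to `Z`,
as a subset of `A`. -/
noncomputable def notOverLocus (e : A.PartialIso A) (q : A ⟶ Z) : Set A :=
  e.source.ι '' (Set.range (equalizer.ι (e.source.ι ≫ q) (e.iso.hom ≫ e.target.ι ≫ q)))ᶜ

lemma isOpen_notOverLocus [Z.IsSeparated] (e : A.PartialIso A) (q : A ⟶ Z) :
    IsOpen (notOverLocus e q) :=
  e.source.ι.isOpenEmbedding.isOpenMap _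
    (equalizer.ι (e.source.ι ≫ q)
      (e.iso.hom ≫ e.target.ι ≫ q)).isClosedEmbedding.isClosed_range.isOpen_compl

variable {A' S S' : Scheme.{u}} {j : A' ⟶ A} {p' : A' ⟶ S'} {p : A ⟶ S} {g : S' ⟶ S}

/-- A base change of `e` to a reduced scheme commutes with `q` as soon as it does so on the level
of points. -/
lemma baseChange_isOver_comp_iff [IsReduced A'] [Z.IsSeparated] (sq : IsPullback j p' p g)
    (e : A.PartialIso A) (he : e.IsOver p p) (h₁ h₂) (q : A ⟶ Z) :
    (baseChange sq e he h₁ h₂).IsOver (j ≫ q) (j ≫ q) ↔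
      Disjoint (Set.range j) (notOverLocus e q) := by
  have h := baseChangeHom_restrict sq e.iso.hom he
  have hr : baseChangeHom sq e.iso.hom he ≫ (j ⁻¹ᵁ e.target).ι ≫ j ≫ q =
      j ∣_ e.source ≫ e.iso.hom ≫ e.target.ι ≫ q := by
    rw [← morphismRestrict_ι_assoc, reassoc_of% h]
  have hl : (j ⁻¹ᵁ e.source).ι ≫ j ≫ q = j ∣_ e.source ≫ e.source.ι ≫ q := by
    rw [morphismRestrict_ι_assoc]
  have key : (baseChange sq e he h₁ h₂).IsOver (j ≫ q) (j ≫ q) ↔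
      j ∣_ e.source ≫ e.source.ι ≫ q = j ∣_ e.source ≫ e.iso.hom ≫ e.target.ι ≫ q := by
    rw [← hr, ← hl]
    exact eq_comm
  have hj (x : ↥(j ⁻¹ᵁ e.source)) : ((j ∣_ e.source) x).1 = j x.1 := by
    have := congr($(morphismRestrict_ι j e.source) x)
    exact this
  rw [key, Set.disjoint_left]
  constructor
  · rintro h _ ⟨x, rfl⟩ ⟨u, hu, hux⟩
    have hx : j x ∈ e.source := by
      rw [← hux]
      exact u.2
    refine hu (range_subset_range_equalizer _ _ _ h ⟨⟨x, hx⟩, ?_⟩)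
    exact Subtype.ext ((hj _).trans hux.symm)
  · intro h
    refine comp_eq_of_range_subset_equalizer _ _ _ ?_
    rintro _ ⟨x, rfl⟩
    by_contra hx
    exact h ⟨x.1, rfl⟩ ⟨_, hx, hj x⟩

end NotOverLocus

/-- Equality of rational maps to the separated scheme `Y` holds on the whole common domain, so the
transformation represented by `e` belongs to `Bir(X/Y)` only if `e` itself is over `Y`. -/
lemma mk_mem_relBir_iff {X S Y : Scheme.{u}} {sX : X ⟶ S} [IrreducibleSpace X] [IsReduced X]
    [IrreducibleSpace Y] [Y.IsSeparated] (π : X ⟶ Y) (e : X.PartialIso X) (he : e.IsOver sX sX) :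
    Bir.mk e he ∈ relBir sX π ↔ e.IsOver π π := by
  refine ⟨fun h ↦ ?_, fun h ↦ compHom_eq_of_bir ⟨e, h, rfl⟩⟩
  have h : (e.toPartialMap.compHom π).toRationalMap = π.toPartialMap.toRationalMap := h
  rw [Scheme.PartialMap.toRationalMap_eq_iff] at h
  obtain ⟨W, hW, hW₁, hW₂, h⟩ := h
  obtain ⟨U, hU, V, hV, i⟩ := e
  have hW₁ : W ≤ U := hW₁
  have h : X.homOfLE hW₁ ≫ (i.hom ≫ V.ι) ≫ π = X.homOfLE le_top ≫ X.topIso.hom ≫ π := h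
  have := Opens.isDominant_homOfLE hW hW₁
  refine ext_of_isDominant (ι := X.homOfLE hW₁) ?_
  rw [← Category.assoc i.hom, h]
  simp

section

variable {k : Type u} [Field k] {V X Y : Scheme.{u}} {sV : V ⟶ Spec (.of k)}
  {sX : X ⟶ Spec (.of k)} {sY : Y ⟶ Spec (.of k)}

/-- A member of a family is a transformation over `Y` if and only if its parameter avoids the
image of the locus where the family does not commute with the projection to `Y`. -/
lemma ρ_mem_relBir_iff [IrreducibleSpace X] [IsReduced X] [IrreducibleSpace Y] [Y.IsSeparated]
    (π : X ⟶ Y) (F : AlgFamily sV sX) (v : RatPoint sV) :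
    F.ρ v ∈ relBir sX π ↔
      v.point ∉ pullback.fst sV sX '' notOverLocus F.θ (pullback.snd sV sX ≫ π) := by
  have h : fibreIncl sX v ≫ pullback.snd sV sX ≫ π = π := by
    have : fibreIncl sX v ≫ pullback.snd sV sX = 𝟙 X := pullback.lift_snd _ _ _
    rw [reassoc_of% this]
  refine (mk_mem_relBir_iff π _ _).trans ?_
  have := baseChange_isOver_comp_iff (isPullback_fibreIncl v) F.θ F.isOver
    (dense_fibre v _ F.surjective_source) (dense_fibre v _ F.surjective_target)
    (pullback.snd sV sX ≫ π)
  rw [h] at this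
  rw [this, Set.disjoint_left]
  constructor
  · rintro h ⟨u, hu, hu'⟩
    obtain ⟨x, rfl⟩ := exists_fibreIncl_eq v u hu'
    exact h ⟨x, rfl⟩ hu
  · rintro h _ ⟨x, rfl⟩ hx
    exact h ⟨_, hx, fst_fibreIncl v x⟩

/-- If all points of `W` avoid the locus of `V` where the members of a family are not
`Y`-morphisms, then the restriction of the family to `W` is a family of `Y`-morphisms. -/
lemma comap_isOver_snd [IsAlgClosed k] [IrreducibleSpace X] [IsReduced X] [Y.IsSeparated]
    (π : X ⟶ Y) (F : AlgFamily sV sX) {W : Scheme.{u}} (i : W ⟶ V) {sW : W ⟶ Spec (.of k)}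
    [LocallyOfFiniteType sW] [IsReduced W] (hi : i ≫ sV = sW ≫ 𝟙 _)
    (h : Disjoint (Set.range i)
      (pullback.fst sV sX '' notOverLocus F.θ (pullback.snd sV sX ≫ π))) :
    (F.comap i hi).θ.IsOver (pullback.snd sW sX ≫ π) (pullback.snd sW sX ≫ π) := by
  have := isReduced_pullback sW sX
  have key := (baseChange_isOver_comp_iff (isPullback_prodMap_id (sX := sX) hi) F.θ F.isOver
    (F.comap i hi).θ.dense_source (F.comap i hi).θ.dense_target (pullback.snd sV sX ≫ π)).mpr (by
      rw [Set.disjoint_left] at h ⊢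
      rintro _ ⟨t, rfl⟩ ht
      refine h ⟨pullback.fst sW sX t, ?_⟩ ⟨_, ht, rfl⟩
      rw [← Scheme.Hom.comp_apply, ← Scheme.Hom.comp_apply, prodMap_fst])
  have h' : prodMap hi (by simp : 𝟙 X ≫ sX = sX ≫ 𝟙 _) ≫ pullback.snd sV sX ≫ π =
      pullback.snd sW sX ≫ π := by
    rw [← Category.assoc, prodMap_snd, Category.comp_id]
  rw [h'] at key
  exact key

/-- The morphism `V × X ⟶ V × Y` induced by `π : X ⟶ Y`. -/
noncomputable def prodRight (sV : V ⟶ Spec (.of k)) {π : X ⟶ Y} (hπ : π ≫ sY = sX) :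
    pullback sV sX ⟶ pullback sV sY :=
  pullback.lift (pullback.fst sV sX) (pullback.snd sV sX ≫ π)
    (by rw [Category.assoc, hπ, pullback.condition])

variable {π : X ⟶ Y} (hπ : π ≫ sY = sX)

lemma prodRight_fst : prodRight sV hπ ≫ pullback.fst sV sY = pullback.fst sV sX :=
  pullback.lift_fst _ _ _

lemma prodRight_snd : prodRight sV hπ ≫ pullback.snd sV sY = pullback.snd sV sX ≫ π :=
  pullback.lift_snd _ _ _

lemma isPullback_prodRight :
    IsPullback (pullback.snd sV sX) (prodRight sV hπ) π (pullback.snd sV sY) := by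
  refine IsPullback.of_bot (v₂₁ := pullback.fst sV sY) (h₃₁ := sV) (v₂₂ := sY) ?_
    (prodRight_snd hπ).symm (IsPullback.of_hasPullback sV sY).flip
  rw [prodRight_fst, hπ]
  exact (IsPullback.of_hasPullback sV sX).flip

lemma isPullback_fibreIncl_prodRight (v : RatPoint sV) :
    IsPullback (fibreIncl sX v) π (prodRight sV hπ) (fibreIncl sY v) := by
  have h₁ : fibreIncl sX v ≫ pullback.fst sV sX = sX ≫ v.1 := pullback.lift_fst _ _ _
  have h₂ : fibreIncl sX v ≫ pullback.snd sV sX = 𝟙 X := pullback.lift_snd _ _ _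
  have h₃ : fibreIncl sY v ≫ pullback.fst sV sY = sY ≫ v.1 := pullback.lift_fst _ _ _
  have h₄ : fibreIncl sY v ≫ pullback.snd sV sY = 𝟙 Y := pullback.lift_snd _ _ _
  refine IsPullback.of_right ?_ ?_ (isPullback_prodRight hπ)
  · rw [h₂, h₄]
    exact IsPullback.of_horiz_isIso ⟨by simp⟩
  · apply pullback.hom_ext
    · rw [Category.assoc, Category.assoc, prodRight_fst, h₁, h₃, reassoc_of% hπ]
    · rw [Category.assoc, Category.assoc, prodRight_snd, reassoc_of% h₂, h₄, Category.comp_id]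

lemma AlgFamily.isOver_prodRight (F : AlgFamily sV sX)
    (h : F.θ.IsOver (pullback.snd sV sX ≫ π) (pullback.snd sV sX ≫ π)) :
    F.θ.IsOver (prodRight sV hπ) (prodRight sV hπ) := by
  apply pullback.hom_ext
  · simp only [Category.assoc, prodRight_fst]
    exact F.isOver
  · simp only [Category.assoc, prodRight_snd]
    exact h

end

/-! ### The Zariski topology -/

section Topology

variable {k : Type u} [Field k] {V X : Scheme.{u}} {sV : V ⟶ Spec (.of k)}
  {sX : X ⟶ Spec (.of k)}

lemma AlgFamily.continuous_ρ [IrreducibleSpace X] (hV : IsVariety sV) (F : AlgFamily sV sX) :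
    Continuous F.ρ := by
  rw [continuous_iff_coinduced_le]
  exact le_iSup_of_le V <| le_iSup_of_le sV <| le_iSup_of_le hV <|
    le_iSup (fun F : AlgFamily sV sX ↦ TopologicalSpace.coinduced F.ρ inferInstance) F

lemma isClosed_bir_iff [IrreducibleSpace X] {D : Set (Bir sX)} :
    IsClosed D ↔ ∀ (V : Scheme.{u}) (sV : V ⟶ Spec (.of k)) (_ : IsVariety sV)
      (F : AlgFamily sV sX), IsClosed (F.ρ ⁻¹' D) := by
  simp only [isClosed_iSup_iff, isClosed_coinduced]

/-- For a closed immersion `W ⟶ V`, the map `W(k) → V(k)` is closed. -/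
lemma RatPoint.isClosed_image {W : Scheme.{u}} (i : W ⟶ V) [IsClosedImmersion i]
    {sW : W ⟶ Spec (.of k)} (hi : i ≫ sV = sW) {A : Set (RatPoint sW)} (hA : IsClosed A) :
    IsClosed {v : RatPoint sV | ∃ w ∈ A, w.1 ≫ i = v.1} := by
  obtain ⟨Q, hQ, rfl⟩ := isClosed_induced_iff.mp hA
  refine isClosed_induced_iff.mpr ⟨i '' Q, i.isClosedEmbedding.isClosedMap _ hQ, ?_⟩
  ext v
  constructor
  · rintro ⟨q, hq, hqv⟩
    obtain ⟨l, hl⟩ := exists_lift_of_range_subset i v.1 (by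
      rintro _ ⟨x, rfl⟩
      exact ⟨q, hqv.trans (v.apply_eq_point x).symm⟩)
    refine ⟨⟨l, by rw [← hi, reassoc_of% hl, v.2]⟩, ?_, hl⟩
    have : i (l (IsLocalRing.closedPoint k)) = v.point := congr($hl (IsLocalRing.closedPoint k))
    have : l (IsLocalRing.closedPoint k) = q :=
      i.isClosedEmbedding.injective (this.trans hqv.symm)
    rw [← this] at hq
    exact hq
  · rintro ⟨w, hw, hwv⟩
    exact ⟨w.point, hw, congr($hwv (IsLocalRing.closedPoint k))⟩

end Topology

/-! ### Extension of the base field -/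

section BaseField

variable {k K : Type u} [Field k] [Field K] {V : Scheme.{u}} {sV : V ⟶ Spec (.of k)}

/-- The `K`-rational point of `V_K` defined by a `k`-rational point of `V`. -/
noncomputable def RatPoint.baseExtend (t : Spec (.of K) ⟶ Spec (.of k)) (v : RatPoint sV) :
    RatPoint (pullback.snd sV t) :=
  ⟨pullback.lift (t ≫ v.1) (𝟙 _) (by rw [Category.assoc, v.2, Category.comp_id, Category.id_comp]),
    pullback.lift_snd _ _ _⟩

variable (t : Spec (.of K) ⟶ Spec (.of k))

lemma RatPoint.baseExtend_fst (v : RatPoint sV) :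
    (v.baseExtend t).1 ≫ pullback.fst sV t = t ≫ v.1 :=
  pullback.lift_fst _ _ _

/-- The map `V(k) → V_K(K)` is continuous: the projection `V_K ⟶ V` is open, and its fibre over a
rational point of `V` consists of a single point. -/
lemma RatPoint.continuous_point_baseExtend :
    Continuous fun v : RatPoint sV ↦ (v.baseExtend t).point := by
  refine continuous_def.mpr fun Q hQ ↦ ?_
  refine isOpen_induced_iff.mpr
    ⟨pullback.fst sV t '' Q, (pullback.fst sV t).isOpenMap _ hQ, ?_⟩
  ext v
  have hv : pullback.fst sV t (v.baseExtend t).point = v.point := by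
    refine Eq.trans ?_ (v.apply_eq_point (t (IsLocalRing.closedPoint K)))
    exact congr($(v.baseExtend_fst t) (IsLocalRing.closedPoint K))
  constructor
  · rintro ⟨y, hy, hyv⟩
    have sq : IsPullback (v.baseExtend t).1 t (pullback.fst sV t) v.1 := by
      refine IsPullback.of_right (h₁₂ := pullback.snd sV t) (v₁₃ := t) (h₂₂ := sV) ?_
        (v.baseExtend_fst t) (IsPullback.of_hasPullback sV t).flip
      rw [(v.baseExtend t).2, v.2]
      exact IsPullback.of_horiz_isIso ⟨by simp⟩
    obtain ⟨x, hx, -⟩ := Scheme.exists_preimage_of_isPullback sq y (IsLocalRing.closedPoint k) hyv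
    have hx : (v.baseExtend t).1 x = y := hx
    rw [RatPoint.apply_eq_point] at hx
    exact (hx ▸ hy : (v.baseExtend t).point ∈ Q)
  · exact fun h ↦ ⟨_, h, hv⟩

lemma isVariety_baseExtend_opens [IsAlgClosed k] (hV : IsVariety sV)
    (O : (pullback sV t).Opens) : IsVariety (O.ι ≫ pullback.snd sV t) := by
  have := hV.isReduced
  have := hV.isSeparated
  have := hV.locallyOfFiniteType
  have := hV.quasiCompact
  have : IsReduced (pullback sV t) := isReduced_pullback sV t
  have : IsLocallyNoetherian (pullback sV t) :=
    LocallyOfFiniteType.isLocallyNoetherian (pullback.snd sV t)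
  exact ⟨inferInstance, inferInstance, inferInstance, inferInstance⟩

end BaseField

/-! ### Base change of families to the geometric generic fibre -/

section GeometricGenericFibre

variable {k : Type u} [Field k] {V X Y : Scheme.{u}} [IsIntegral Y] {sV : V ⟶ Spec (.of k)}
  {sX : X ⟶ Spec (.of k)} {sY : Y ⟶ Spec (.of k)} {π : X ⟶ Y} (hπ : π ≫ sY = sX)
  (K : Type u) [Field K] [Algebra Y.functionField K]

lemma geomGenericFibre_condition {π : X ⟶ Y} (hπ : π ≫ sY = sX) :
    pullback.fst π (geomGenericPoint Y K) ≫ sX =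
    geomGenericFibreStr π K ≫ geomGenericPoint Y K ≫ sY := by
  rw [← hπ, pullback.condition_assoc]

/-- The product `V' ×_K X_K` is the base change of `V × X ⟶ V × Y` along `V' ⟶ V × Y`. -/
lemma isPullback_prodMap_geomGenericFibre {V' : Scheme.{u}} {sV' : V' ⟶ Spec (.of K)}
    {c : V' ⟶ V} (hc : c ≫ sV = sV' ≫ geomGenericPoint Y K ≫ sY) :
    IsPullback (prodMap hc (geomGenericFibre_condition K hπ)) (pullback.fst _ _)
      (prodRight sV hπ) (pullback.lift c (sV' ≫ geomGenericPoint Y K) (by simpa using hc)) := by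
  refine IsPullback.of_right (h₁₂ := pullback.snd sV sX) (v₁₃ := π) (h₂₂ := pullback.snd sV sY)
    ?_ ?_ (isPullback_prodRight hπ)
  · rw [prodMap_snd, pullback.lift_snd]
    exact (IsPullback.of_hasPullback _ _).flip.paste_horiz (IsPullback.of_hasPullback _ _)
  · apply pullback.hom_ext
    · rw [Category.assoc, Category.assoc, prodRight_fst, prodMap_fst, pullback.lift_fst]
    · rw [Category.assoc, Category.assoc, prodRight_snd, pullback.lift_snd,
        ← Category.assoc, prodMap_snd, Category.assoc, pullback.condition, pullback.condition_assoc]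

/-- The geometric generic fibre as the base change of `V × X ⟶ V × Y`, for a rational point
of `V`. -/
lemma isPullback_fst_fibreIncl (v : RatPoint sV) :
    IsPullback (pullback.fst π (geomGenericPoint Y K) ≫ fibreIncl sX v) (geomGenericFibreStr π K)
      (prodRight sV hπ) (geomGenericPoint Y K ≫ fibreIncl sY v) :=
  (IsPullback.of_hasPullback _ _).paste_horiz (isPullback_fibreIncl_prodRight hπ v)

variable [IrreducibleSpace X] [IsDominant π] [IrreducibleSpace (geomGenericFibre π K)]

lemma dense_fst_fibreIncl (v : RatPoint sV) (U : (pullback sV sX).Opens)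
    (hU : Surjective (U.ι ≫ pullback.fst sV sX)) :
    Dense ((pullback.fst π (geomGenericPoint Y K) ≫ fibreIncl sX v) ⁻¹ᵁ U :
      Set ↥(geomGenericFibre π K)) :=
  dense_preimage (pullback.fst π (geomGenericPoint Y K)) _ (dense_fibre v U hU)

variable [IsReduced X] [Y.IsSeparated]

/-- For a family of `Y`-morphisms, `ρ_θ(v)_K` is the base change of `θ` along
`X_K ⟶ X ⟶ V × X`. -/
lemma geomPullback_ρ (F : AlgFamily sV sX) (hF : F.θ.IsOver (prodRight sV hπ) (prodRight sV hπ))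
    (v : RatPoint sV) (hv : F.ρ v ∈ relBir sX π) :
    geomPullback π K sX ⟨F.ρ v, hv⟩ = Bir.mk (baseChange (isPullback_fst_fibreIncl hπ K v) F.θ hF
      (dense_fst_fibreIncl K v _ F.surjective_source)
      (dense_fst_fibreIncl K v _ F.surjective_target)) (baseChange_isOver _ _ _ _ _) := by
  have h := (mk_mem_relBir_iff π _ _).mp hv
  refine (pullbackBir_eq sX (IsPullback.of_hasPullback π (geomGenericPoint Y K)) ⟨F.ρ v, hv⟩ _ h
    rfl).trans ?_
  exact Bir.ext (congrArg Scheme.PartialIso.toRationalMap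
    (baseChange_baseChange _ _ _ _ _ _ _ _ _ _ _ _ _))

/-- A family of birational `Y`-morphisms parametrized by `V` extends to a family of birational
transformations of `X_K` parametrized by an open subset `O` of `V_K` which contains `V(k)`.
In general `O ≠ V_K`: for `V = Y`, the family might be undefined along the graph of `π`. -/
lemma exists_family_geomGenericFibre [IsAlgClosed k] [IsAlgClosed K] (hV : IsVariety sV)
    (F : AlgFamily sV sX) (hF : F.θ.IsOver (prodRight sV hπ) (prodRight sV hπ)) :
    ∃ (O : (pullback sV (geomGenericPoint Y K ≫ sY)).Opens)
      (G : AlgFamily (O.ι ≫ pullback.snd sV (geomGenericPoint Y K ≫ sY))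
        (geomGenericFibreStr π K)),
      ∀ v : RatPoint sV, ∃ w : RatPoint (O.ι ≫ pullback.snd sV (geomGenericPoint Y K ≫ sY)),
        w.1 ≫ O.ι = (v.baseExtend (geomGenericPoint Y K ≫ sY)).1 ∧
        ∀ hv : F.ρ v ∈ relBir sX π, geomPullback π K sX ⟨F.ρ v, hv⟩ = G.ρ w := by
  have := hV.locallyOfFiniteType
  let t := geomGenericPoint Y K ≫ sY
  let s := pullback.snd sV t
  let j := prodMap (pullback.condition : pullback.fst sV t ≫ sV = s ≫ t)
    (geomGenericFibre_condition K hπ)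
  let A := j ⁻¹ᵁ F.θ.source
  let B := j ⁻¹ᵁ F.θ.target
  let p := pullback.fst s (geomGenericFibreStr π K)
  let O : (pullback sV t).Opens :=
    ⟨(p '' A) ∩ (p '' B), (p.isOpenMap _ A.2).inter (p.isOpenMap _ B.2)⟩
  have hO : O.ι ≫ s = (O.ι ≫ s) ≫ 𝟙 _ := (Category.comp_id _).symm
  have sq₁ := isPullback_prodMap_id (sX := geomGenericFibreStr π K) hO
  have sq := sq₁.paste_horiz (isPullback_prodMap_geomGenericFibre hπ K
    (pullback.condition : pullback.fst sV t ≫ sV = s ≫ t))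
  have hA : Set.range O.ι ⊆ p '' A := by
    rw [Scheme.Opens.range_ι]
    exact Set.inter_subset_left
  have hB : Set.range O.ι ⊆ p '' B := by
    rw [Scheme.Opens.range_ι]
    exact Set.inter_subset_right
  have hfib (v : RatPoint sV) : fibreIncl (geomGenericFibreStr π K) (v.baseExtend t) ≫ j =
      pullback.fst π (geomGenericPoint Y K) ≫ fibreIncl sX v :=
    fibreIncl_prodMap _ _ _ v (v.baseExtend_fst t)
  have hmem (v : RatPoint sV) (U : (pullback sV sX).Opens)
      (hU : Surjective (U.ι ≫ pullback.fst sV sX)) :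
      (v.baseExtend t).point ∈ p '' (j ⁻¹ᵁ U : Set _) := by
    obtain ⟨x, hx⟩ := (dense_fst_fibreIncl (π := π) K v U hU).nonempty
    refine ⟨fibreIncl (geomGenericFibreStr π K) (v.baseExtend t) x, ?_, fst_fibreIncl _ x⟩
    rw [← hfib] at hx
    exact hx
  refine ⟨O, F.ofIsPullback sq hF (surjective_preimage sq₁ A hA) (surjective_preimage sq₁ B hB),
    fun v ↦ ?_⟩
  have hr : Set.range (v.baseExtend t).1 ⊆ Set.range O.ι := by
    rw [Scheme.Opens.range_ι]
    rintro _ ⟨x, rfl⟩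
    rw [RatPoint.apply_eq_point]
    exact ⟨hmem v _ F.surjective_source, hmem v _ F.surjective_target⟩
  have hw := IsOpenImmersion.lift_fac O.ι (v.baseExtend t).1 hr
  let w : RatPoint (O.ι ≫ s) :=
    ⟨IsOpenImmersion.lift O.ι (v.baseExtend t).1 hr, by
      rw [reassoc_of% hw]
      exact (v.baseExtend t).2⟩
  refine ⟨w, hw, fun hv ↦ (geomPullback_ρ hπ K F hF v hv).trans ?_⟩
  refine (F.ρ_ofIsPullback sq hF _ _ w (isPullback_fst_fibreIncl hπ K v) ?_ hF _ _).symm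
  have h₁ := fibreIncl_prodMap (sX := geomGenericFibreStr π K) (sX' := geomGenericFibreStr π K)
    (f := 𝟙 _) hO (by simp) w (v.baseExtend t) (hw.trans (Category.id_comp _).symm)
  rw [reassoc_of% h₁]
  exact (Category.id_comp _).trans (hfib v)

/-- In a family of `Y`-morphisms, membership of `ρ_θ(v)_K` in a closed set is a closed condition
on the parameter `v`. -/
lemma isClosed_setOf_geomPullback_mem [IsAlgClosed k] [IsAlgClosed K] (hV : IsVariety sV)
    (F : AlgFamily sV sX) (hF : F.θ.IsOver (prodRight sV hπ) (prodRight sV hπ))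
    {C : Set (Bir (geomGenericFibreStr π K))} (hC : IsClosed C)
    (hmem : ∀ v, F.ρ v ∈ relBir sX π) :
    IsClosed {v | geomPullback π K sX ⟨F.ρ v, hmem v⟩ ∈ C} := by
  obtain ⟨O, G, hG⟩ := exists_family_geomGenericFibre hπ K hV F hF
  choose w hw hG using hG
  have hcont : Continuous w := by
    refine continuous_induced_rng.mpr (O.ι.isOpenEmbedding.isInducing.continuous_iff.mpr ?_)
    have h : O.ι ∘ RatPoint.point ∘ w = fun v : RatPoint sV ↦ (v.baseExtend _).point :=
      funext fun v ↦ congr($(hw v) (IsLocalRing.closedPoint K))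
    rw [h]
    exact RatPoint.continuous_point_baseExtend _
  have h : {v | geomPullback π K sX ⟨F.ρ v, hmem v⟩ ∈ C} = w ⁻¹' (G.ρ ⁻¹' C) := by
    ext v
    simp only [Set.mem_ofPred_eq, Set.mem_preimage, hG v (hmem v)]
  rw [h]
  exact (hC.preimage (G.continuous_ρ (isVariety_baseExtend_opens _ hV O))).preimage hcont

lemma continuous_geomPullback [IsAlgClosed k] [IsAlgClosed K] (hπ : π ≫ sY = sX) :
    Continuous (geomPullback π K sX) := by
  refine continuous_iff_isClosed.mpr fun C hC ↦ isClosed_induced_iff.mpr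
    ⟨Subtype.val '' (geomPullback π K sX ⁻¹' C), ?_,
      Set.preimage_image_eq _ Subtype.val_injective⟩
  refine isClosed_bir_iff.mpr fun V sV hV F ↦ ?_
  have := hV.isSeparated
  have := hV.locallyOfFiniteType
  have := hV.quasiCompact
  -- The parameters of the members of the family which belong to `Bir(X/Y)` form a closed set,
  -- since `V × X ⟶ V` is open.
  let N := pullback.fst sV sX '' notOverLocus F.θ (pullback.snd sV sX ≫ π)
  have hN : IsOpen N := (pullback.fst sV sX).isOpenMap _ (isOpen_notOverLocus _ _)
  obtain ⟨W, i, hW, hi, hrange⟩ := exists_reduced_closed_subscheme hN.isClosed_compl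
  have hiV : i ≫ sV = (i ≫ sV) ≫ 𝟙 _ := (Category.comp_id _).symm
  have hWV : IsVariety (i ≫ sV) := ⟨hW, inferInstance, inferInstance, inferInstance⟩
  have hdisj : Disjoint (Set.range i) N := hrange ▸ disjoint_compl_left
  have hG := (F.comap i hiV).isOver_prodRight hπ (comap_isOver_snd π F i hiV hdisj)
  have hρ (w : RatPoint (i ≫ sV)) (v : RatPoint sV) (hwv : w.1 ≫ i = v.1) :
      (F.comap i hiV).ρ w = F.ρ v := F.ρ_comap i hiV w v hwv
  have hpoint (w : RatPoint (i ≫ sV)) (v : RatPoint sV) (hwv : w.1 ≫ i = v.1) :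
      v.point = i w.point := congr($hwv.symm (IsLocalRing.closedPoint k))
  have hmem (w : RatPoint (i ≫ sV)) : (F.comap i hiV).ρ w ∈ relBir sX π := by
    let v : RatPoint sV := ⟨w.1 ≫ i, by rw [Category.assoc, w.2]⟩
    rw [hρ w v rfl, ρ_mem_relBir_iff, hpoint w v rfl]
    exact Set.disjoint_left.mp hdisj ⟨_, rfl⟩
  convert! RatPoint.isClosed_image i rfl
    (isClosed_setOf_geomPullback_mem hπ K hWV (F.comap i hiV) hG hC hmem) using 1
  ext v
  constructor
  · rintro ⟨⟨φ, hφ⟩, hφC, hφv⟩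
    have hφv : φ = F.ρ v := hφv
    subst hφv
    have hv : v.point ∈ Set.range i := hrange ▸ (ρ_mem_relBir_iff π F v).mp hφ
    obtain ⟨l, hl⟩ := exists_lift_of_range_subset i v.1 (by
      rintro _ ⟨x, rfl⟩
      rwa [v.apply_eq_point])
    let w : RatPoint (i ≫ sV) := ⟨l, by rw [reassoc_of% hl, v.2]⟩
    refine ⟨w, ?_, hl⟩
    simp only [Set.mem_ofPred_eq, hρ w v hl]
    exact hφC
  · rintro ⟨w, hw, hwv⟩
    exact ⟨⟨_, hmem w⟩, hw, hρ w v hwv⟩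

end GeometricGenericFibre

/-! ### Injectivity -/

section Injective

/-- The base change to `X'` determines the composition with the dominant morphism `X' ⟶ X`, which
can be cancelled since `X` is reduced and separated. -/
lemma pullbackBir_injective {X S Y T X' : Scheme.{u}} (sX : X ⟶ S) {π : X ⟶ Y} {g' : X' ⟶ X}
    {p' : X' ⟶ T} {g : T ⟶ Y} [IrreducibleSpace X] [IrreducibleSpace Y] [IrreducibleSpace X']
    [IsDominant g'] [IsReduced X] [X.IsSeparated] (sq : IsPullback g' p' π g) :
    Function.Injective (pullbackBir sX sq) := by
  intro φ ψ h
  obtain ⟨e, he, heφ⟩ := exists_rep φ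
  obtain ⟨d, hd, hdψ⟩ := exists_rep ψ
  rw [pullbackBir_eq sX sq φ e he heφ, pullbackBir_eq sX sq ψ d hd hdψ] at h
  refine Subtype.ext (Bir.ext (heφ.symm.trans (Eq.trans ?_ hdψ)))
  have h := congrArg Subtype.val h
  obtain ⟨W, hW, hWe, hWd, h⟩ := (Scheme.PartialMap.toRationalMap_eq_iff).mp h
  refine (Scheme.PartialMap.toRationalMap_eq_iff).mpr ⟨e.source ⊓ d.source,
    e.dense_source.inter_of_isOpen_left d.dense_source e.source.2, inf_le_left, inf_le_right, ?_⟩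
  have hWe : W ≤ g' ⁻¹ᵁ e.source := hWe
  have hWd : W ≤ g' ⁻¹ᵁ d.source := hWd
  have h : X'.homOfLE hWe ≫ baseChangeHom sq e.iso.hom he ≫ (g' ⁻¹ᵁ e.target).ι =
      X'.homOfLE hWd ≫ baseChangeHom sq d.iso.hom hd ≫ (g' ⁻¹ᵁ d.target).ι := h
  have hW' : W ≤ g' ⁻¹ᵁ (e.source ⊓ d.source) := le_inf hWe hWd
  have := Opens.isDominant_homOfLE hW hW'
  have hres : IsDominant (g' ∣_ (e.source ⊓ d.source)) :=
    IsZariskiLocalAtTarget.restrict ‹IsDominant g'› _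
  have hdom : IsDominant (X'.homOfLE hW' ≫ g' ∣_ (e.source ⊓ d.source)) :=
    (IsDominant.comp_iff _ _).mpr hres
  have key (f : X.PartialIso X) (hf : f.IsOver π π) (hWf : W ≤ g' ⁻¹ᵁ f.source)
      (hle : e.source ⊓ d.source ≤ f.source) :
      X'.homOfLE hW' ≫ (g' ∣_ (e.source ⊓ d.source)) ≫ X.homOfLE hle ≫ f.iso.hom ≫ f.target.ι =
        (X'.homOfLE hWf ≫ baseChangeHom sq f.iso.hom hf ≫ (g' ⁻¹ᵁ f.target).ι) ≫ g' := by
    have h₁ : X'.homOfLE hW' ≫ (g' ∣_ (e.source ⊓ d.source)) ≫ X.homOfLE hle =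
        X'.homOfLE hWf ≫ g' ∣_ f.source := by
      rw [← cancel_mono f.source.ι]
      simp
    rw [reassoc_of% h₁, Category.assoc, Category.assoc, ← morphismRestrict_ι,
      reassoc_of% baseChangeHom_restrict sq f.iso.hom hf]
  change X.homOfLE inf_le_left ≫ e.iso.hom ≫ e.target.ι =
    X.homOfLE inf_le_right ≫ d.iso.hom ≫ d.target.ι
  refine ext_of_isDominant (ι := X'.homOfLE hW' ≫ g' ∣_ (e.source ⊓ d.source)) ?_
  exact (Category.assoc _ _ _).trans ((key e he hWe inf_le_left).trans
    ((congrArg (· ≫ g') h).trans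
      ((key d hd hWd inf_le_right).symm.trans (Category.assoc _ _ _).symm)))

end Injective

end BirationalFamilies

theorem mainTheorem7 {k : Type u} [Field k] [IsAlgClosed k] {X Y : Scheme.{u}}
    [IsIntegral X] [IsIntegral Y] (sX : X ⟶ Spec (.of k)) (sY : Y ⟶ Spec (.of k))
    (hX : BirationalFamilies.IsVariety sX) (hY : BirationalFamilies.IsVariety sY)
    (π : X ⟶ Y) (hπ : π ≫ sY = sX) [IsDominant π]
    (K : Type u) [Field K] [Algebra Y.functionField K] [IsAlgClosure Y.functionField K]
    [IrreducibleSpace (BirationalFamilies.geomGenericFibre π K)]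
    (hXK : BirationalFamilies.IsVariety (BirationalFamilies.geomGenericFibreStr π K)) :
    Function.Injective (BirationalFamilies.geomPullback π K sX) ∧
      Continuous (BirationalFamilies.geomPullback π K sX) := by
  have := hX.isSeparated
  have := hY.isSeparated
  have := BirationalFamilies.isSeparated_of_isSeparated_over_affine sX
  have := BirationalFamilies.isSeparated_of_isSeparated_over_affine sY
  have : IsAlgClosed K := IsAlgClosure.isAlgClosed Y.functionField
  exact ⟨BirationalFamilies.pullbackBir_injective sX _,
    BirationalFamilies.continuous_geomPullback K hπ⟩
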